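/- Let $G$ be a separable locally compact Hausdorff abelian group, written additively, such that $x\mapsto 2x$ is a bijection of $G$. Let $T=\{z\in\mathbf C : |z|=1\}$ and let $m\colon G\times G\to T$ be a symplectic bicharacter, i.e. $m$ is continuous, a homomorphism in each argument, satisfies $m(x,y)m(y,x)=1$ and $m(x,x)=1$, and $y\mapsto m(\cdot,y)$ is an isomorphism of topological groups from $G$ onto its dual $\widehat G$. Let $L\subset G$ be a compact subgroup that is maximal among the subgroups on which $m$ is identically $1$. Put $2L=\{2x : x\in L\}$ and $L/2=\{x\in G : 2x\in L\}$, and assume $L\neq 2L$. For a topological abelian group $X$ and a map $n\colon X\times X\to T$, an $n$-representation of $X$ on a Hilbert space $\mathcal K$ is a map $U$ from $X$ to the unitary operators of $\mathcal K$ with $U(0)=1$ and $U(x)U(y)=n(x,y)U(x+y)$ that is Borel, in the sense that every orbit map $x\mapsto U(x)\psi$ is Borel with separable range; $n$ is called the multiplier of $U$. It is irreducible if $\mathcal K\neq 0$ and the only closed invariant subspaces are $0$ and $\mathcal K$. Let $W$ be an irreducible $m$-representation of $G$ on a complex Hilbert space $\mathcal H$ and let $\mathcal H^L=\{\psi\in\mathcal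 H : W(a)\psi=\psi\ \text{for all } a\in L\}$ be the vacuum space. Then: 1. There is a projective representation $W^L_0$ of $(L/2)/L$ on $\mathcal H^L$, with some multiplier $m_{0,L/2}$, whose lift to $L/2$ is projectively equivalent to $W|_{L/2}$ acting on $\mathcal H^L$; that is, $W^L_0$ is an $m_{0,L/2}$-representation and there is a function $a\colon L/2\to T$ with $W^L_0(x+L)\psi=a(x)W(x)\psi$ for all $x\in L/2$ and $\psi\in\mathcal H^L$. 2. For every such $W^L_0$ and $m_{0,L/2}$, $W^L_0$ is irreducible, and it is the unique irreducible $m_{0,L/2}$-representation of $(L/2)/L$: every irreducible $m_{0,L/2}$-representation of $(L/2)/L$ on a complex Hilbert space is unitarily equivalent to it. 3. There is a positive integer $d$ such that $\dim\mathcal H^L=2^d$ and $|(L/2)/L|=2^{2d}$. -/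

import Mathlib

/-- A bicharacter of a topological abelian group: a continuous map to the circle group
that is a character in each argument. -/
structure IsBicharacter {G : Type*} [AddCommGroup G] [TopologicalSpace G]
    (b : G → G → Circle) : Prop where
  continuous : Continuous (fun p : G × G => b p.1 p.2)
  map_add_left : ∀ x y z, b (x + y) z = b x z * b y z
  map_add_right : ∀ x y z, b x (y + z) = b x y * b x z

/-- A symplectic bicharacter: an alternating bicharacter `b` for which `y ↦ b (·, y)` is an
isomorphism of topological groups from `G` onto its Pontryagin dual. -/
structure IsSymplecticBicharacter {G : Type*} [AddCommGroup G] [TopologicalSpace G]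
    (b : G → G → Circle) : Prop extends IsBicharacter b where
  mul_swap : ∀ x y, b x y * b y x = 1
  self_eq_one : ∀ x, b x x = 1
  iso : ∃ e : Multiplicative G ≃ₜ* PontryaginDual (Multiplicative G),
    ∀ x y : G, e (Multiplicative.ofAdd y) (Multiplicative.ofAdd x) = b x y

/-- A subgroup is isotropic for `b` if `b` is identically `1` on it. -/
def IsIsotropic {G : Type*} [AddCommGroup G] (b : G → G → Circle) (A : AddSubgroup G) : Prop :=
  ∀ x ∈ A, ∀ y ∈ A, b x y = 1

/-- An `m`-representation of `G`: a Borel map `U` of `G` into the unitary group of `H` with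
`U x U y = m(x, y) U (x + y)` and `U 0 = 1`. Borel means that each orbit map `x ↦ U x ψ` is
strongly measurable for the Borel sigma-algebra of `G`; for separable `H` this is the same as
all matrix coefficients being Borel functions. -/
structure IsMRep {G : Type*} [AddCommGroup G] [TopologicalSpace G]
    {H : Type*} [NormedAddCommGroup H] [InnerProductSpace ℂ H]
    (m : G → G → Circle) (U : G → (H ≃ₗᵢ[ℂ] H)) : Prop where
  map_zero : ∀ ψ, U 0 ψ = ψ
  map_map : ∀ x y ψ, U x (U y ψ) = (m x y : ℂ) • U (x + y) ψ
  borel : ∀ ψ, @MeasureTheory.StronglyMeasurable G H _ (borel G) (fun x => U x ψ)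

/-- A family of unitary operators is irreducible if the Hilbert space is nonzero and has no
closed invariant subspaces besides zero and the whole space. -/
structure IsIrreducibleFamily {G : Type*} {H : Type*} [NormedAddCommGroup H]
    [InnerProductSpace ℂ H] (U : G → (H ≃ₗᵢ[ℂ] H)) : Prop where
  nontrivial : Nontrivial H
  eq_bot_or_eq_top : ∀ K : Submodule ℂ H, IsClosed (K : Set H) →
    (∀ x, ∀ ψ ∈ K, U x ψ ∈ K) → K = ⊥ ∨ K = ⊤

/-- `2L`, the image of `L` under `x ↦ 2x`. -/
def doubleSubgroup {G : Type*} [AddCommGroup G] (L : AddSubgroup G) : AddSubgroup G :=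
  L.map (nsmulAddMonoidHom 2)

/-- `L/2`, the inverse image of `L` under `x ↦ 2x`. -/
def halfSubgroup {G : Type*} [AddCommGroup G] (L : AddSubgroup G) : AddSubgroup G :=
  L.comap (nsmulAddMonoidHom 2)

/-- The quotient group `(L/2)/L`, with the quotient topology. -/
abbrev HalfQuotient {G : Type*} [AddCommGroup G] (L : AddSubgroup G) : Type _ :=
  ↥(halfSubgroup L) ⧸ L.addSubgroupOf (halfSubgroup L)

/-- The vacuum space: the vectors fixed by all `W a`, `a ∈ L`. -/
def vacuumSpace {G : Type*} [AddCommGroup G] {H : Type*} [NormedAddCommGroup H]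
    [InnerProductSpace ℂ H] (W : G → (H ≃ₗᵢ[ℂ] H)) (L : AddSubgroup G) : Submodule ℂ H where
  carrier := {ψ | ∀ a ∈ L, W a ψ = ψ}
  add_mem' := by
    intro φ ψ hφ hψ a ha
    rw [map_add, hφ a ha, hψ a ha]
  zero_mem' := by
    intro a _
    exact map_zero (W a)
  smul_mem' := by
    intro c ψ hψ a ha
    rw [map_smul, hψ a ha]

/-- `W₀` is a projective representation of `(L/2)/L` on the vacuum space, with multiplier `m₀`,
whose lift to `L/2` is projectively equivalent to the action of `W` restricted to `L/2`:
`W₀ (x + L) = a x • W x` on the vacuum space, for a circle-valued function `a` on `L/2`. -/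
structure IsVacuumDescent {G : Type*} [AddCommGroup G] [TopologicalSpace G] {H : Type*}
    [NormedAddCommGroup H] [InnerProductSpace ℂ H] (W : G → (H ≃ₗᵢ[ℂ] H)) (L : AddSubgroup G)
    (m₀ : HalfQuotient L → HalfQuotient L → Circle)
    (W₀ : HalfQuotient L → (vacuumSpace W L ≃ₗᵢ[ℂ] vacuumSpace W L)) : Prop where
  isMRep : IsMRep m₀ W₀
  lift : ∃ a : halfSubgroup L → Circle, ∀ (x : halfSubgroup L) (ψ : vacuumSpace W L),
    (W₀ (QuotientAddGroup.mk x) ψ : H) = (a x : ℂ) • W (x : G) (ψ : H)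

/-! Since `m` is alternating, `W x` and `W y` commute up to the phase `m (2x) y`. Maximality makes
`L` its own annihilator, so `L/2` consists of the `x` for which `W x` commutes with all of `W(L)`.
Such `W x` preserve the vacuum space, the remaining ones send it to an orthogonal subspace, and
`W(L)` fixes it; hence `W` descends, up to phases, to `(L/2)/L`. The descended commutator `m (2x) y`
is nondegenerate there because doubling maps `L/2` onto `L`.

The quotient is finite (`L/2` is compact, `L` is open in it) and killed by 2. The vacuum space is
nonzero because some Fourier coefficient over `L` of an orbit is nonzero
(`IsMRep.nontrivial_vacuumSpace`), and irreducibility passes down to it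
(`IsVacuumDescent.isIrreducibleFamily`). The rest is finite Stone–von Neumann theory: averaging
rank-one operators gives uniqueness (`IsMRep.exists_unitary_equiv`) and `dim² = |(L/2)/L|`
(`IsMRep.finrank_sq_eq_card`), a power of 2. -/

open scoped InnerProductSpace

/-! ### Multiplier representations of a finite group: averaging -/

/-- The commutator `m(u, v) / m(v, u)` of a multiplier. -/
noncomputable def multiplierCommutator {V : Type*} (m : V → V → Circle) (u v : V) : Circle :=
  m u v / m v u

/-- The operator `∑ᵥ U'(v) |β⟩⟨α| U(v)⁻¹`. -/
noncomputable def averagedRankOne {V : Type*} [Fintype V]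
    {A : Type*} [NormedAddCommGroup A] [InnerProductSpace ℂ A]
    {B : Type*} [NormedAddCommGroup B] [InnerProductSpace ℂ B]
    (U : V → (A ≃ₗᵢ[ℂ] A)) (U' : V → (B ≃ₗᵢ[ℂ] B)) (α : A) (β : B) : A →L[ℂ] B :=
  ∑ v, (innerSL ℂ (U v α)).smulRight (U' v β)

theorem averagedRankOne_apply {V : Type*} [Fintype V]
    {A : Type*} [NormedAddCommGroup A] [InnerProductSpace ℂ A]
    {B : Type*} [NormedAddCommGroup B] [InnerProductSpace ℂ B]
    (U : V → (A ≃ₗᵢ[ℂ] A)) (U' : V → (B ≃ₗᵢ[ℂ] B)) (α ξ : A) (β : B) :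
    averagedRankOne U U' α β ξ = ∑ v, ⟪U v α, ξ⟫_ℂ • U' v β := by
  simp [averagedRankOne]

theorem Circle.conj_coe_mul_coe (z : Circle) : (starRingEnd ℂ) (z : ℂ) * z = 1 := by
  rw [← Circle.coe_inv_eq_conj, ← Circle.coe_mul, inv_mul_cancel, Circle.coe_one]

section MRep

variable {V : Type*} [AddCommGroup V] [TopologicalSpace V]
  {A : Type*} [NormedAddCommGroup A] [InnerProductSpace ℂ A]
  {B : Type*} [NormedAddCommGroup B] [InnerProductSpace ℂ B]
  {m : V → V → Circle} {U : V → (A ≃ₗᵢ[ℂ] A)} {U' : V → (B ≃ₗᵢ[ℂ] B)}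

theorem IsMRep.map_map_comm (hU : IsMRep m U) (u v : V) (ψ : A) :
    U u (U v ψ) = (multiplierCommutator m u v : ℂ) • U v (U u ψ) := by
  rw [hU.map_map, hU.map_map v u, smul_smul, ← Circle.coe_mul, multiplierCommutator,
    div_mul_cancel, add_comm]

/-- No cocycle identity is assumed of `m`; additivity is read off from a nonzero representation by
moving `U v` past `U u` and `U u'` separately and past their product. -/
theorem IsMRep.multiplierCommutator_add_left [Nontrivial A] (hU : IsMRep m U) (u u' v : V) :
    multiplierCommutator m (u + u') v =
      multiplierCommutator m u v * multiplierCommutator m u' v := by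
  obtain ⟨ψ, hψ⟩ := exists_ne (0 : A)
  have h1 : U u (U u' (U v ψ)) = ((m u u' * multiplierCommutator m (u + u') v : Circle) : ℂ) •
      U v (U (u + u') ψ) := by
    rw [hU.map_map, hU.map_map_comm (u + u') v, smul_smul, Circle.coe_mul]
  have h2 : U u (U u' (U v ψ)) = ((multiplierCommutator m u' v * (multiplierCommutator m u v *
      m u u') : Circle) : ℂ) • U v (U (u + u') ψ) := by
    rw [hU.map_map_comm u' v, map_smul, hU.map_map_comm u v, hU.map_map u u', map_smul,
      smul_smul, smul_smul, Circle.coe_mul, Circle.coe_mul, mul_assoc]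
  have hne : U v (U (u + u') ψ) ≠ 0 := by simpa using hψ
  have h3 := smul_left_injective ℂ hne (h1.symm.trans h2)
  have h4 := Circle.coe_injective h3
  rw [mul_comm (multiplierCommutator m u' v), mul_right_comm, mul_comm _ (m u u')] at h4
  exact mul_left_cancel (G := Circle) h4

theorem IsMRep.multiplierCommutator_zero_right [Nontrivial A] (hU : IsMRep m U) (u : V) :
    multiplierCommutator m u 0 = 1 := by
  obtain ⟨ψ, hψ⟩ := exists_ne (0 : A)
  have h := hU.map_map_comm u 0 ψ
  rw [hU.map_zero, hU.map_zero] at h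
  have hne : U u ψ ≠ 0 := by simpa using hψ
  have h' : ((1 : Circle) : ℂ) • U u ψ = (multiplierCommutator m u 0 : ℂ) • U u ψ := by
    rw [← h, Circle.coe_one, one_smul]
  exact (Circle.coe_injective (smul_left_injective ℂ hne h')).symm

/-- Summed over `u`, the factor produced here is a character sum that isolates the term `v = 0`. -/
theorem IsMRep.inner_map_conj (hU : IsMRep m U) (u v : V) (α β : A) :
    ⟪U v (U u α), U u β⟫_ℂ = (multiplierCommutator m u v : ℂ) * ⟪U v α, β⟫_ℂ := by
  have h : ⟪U u (U v α), U u β⟫_ℂ = ⟪U v α, β⟫_ℂ := (U u).inner_map_map _ _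
  rw [hU.map_map_comm u v, inner_smul_left] at h
  rw [← h, ← mul_assoc, mul_comm (multiplierCommutator m u v : ℂ), Circle.conj_coe_mul_coe, one_mul]

variable [Fintype V]

theorem IsMRep.sum_multiplierCommutator_eq_zero [Nontrivial A] (hU : IsMRep m U) {v : V}
    (hv : ∃ u, multiplierCommutator m u v ≠ 1) :
    ∑ u, (multiplierCommutator m u v : ℂ) = 0 := by
  obtain ⟨u₀, hu₀⟩ := hv
  have h : (multiplierCommutator m u₀ v : ℂ) * ∑ u, (multiplierCommutator m u v : ℂ) =
      ∑ u, (multiplierCommutator m u v : ℂ) := by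
    rw [Finset.mul_sum]
    refine Fintype.sum_equiv (Equiv.addLeft u₀) _ _ fun u => ?_
    rw [Equiv.coe_addLeft, hU.multiplierCommutator_add_left, Circle.coe_mul]
  by_contra h0
  have := mul_right_cancel₀ h0 (h.trans (one_mul _).symm)
  exact hu₀ (Circle.coe_injective (this.trans Circle.coe_one.symm))

/-- The two phases `m w v`, one conjugated by the inner product, cancel because `U` and `U'` share
the multiplier. -/
theorem IsMRep.averagedRankOne_intertwines (hU : IsMRep m U) (hU' : IsMRep m U') (α ξ : A) (β : B)
    (w : V) : averagedRankOne U U' α β (U w ξ) = U' w (averagedRankOne U U' α β ξ) := by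
  rw [averagedRankOne_apply, averagedRankOne_apply, map_sum]
  refine (Fintype.sum_equiv (Equiv.addLeft w) _ _ fun v => ?_).symm
  have h1 : ⟪U v α, ξ⟫_ℂ = (starRingEnd ℂ) (m w v : ℂ) * ⟪U (w + v) α, U w ξ⟫_ℂ := by
    rw [← (U w).inner_map_map, hU.map_map, inner_smul_left]
  rw [Equiv.coe_addLeft, map_smul, hU'.map_map, h1, smul_smul, mul_right_comm,
    Circle.conj_coe_mul_coe, one_mul]

/-- Evaluating each operator at `U u α` and summing over `u` leaves only `v = 0`, by orthogonality
of characters; the total is `|V| ‖α‖² β ≠ 0`. -/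
theorem IsMRep.exists_averagedRankOne_ne_zero (hU : IsMRep m U) (hU' : IsMRep m U')
    (hnd : ∀ v, v ≠ 0 → ∃ u, multiplierCommutator m u v ≠ 1) {α : A} (hα : α ≠ 0)
    {β : B} (hβ : β ≠ 0) : ∃ u, averagedRankOne U U' (U u α) β ≠ 0 := by
  classical
  have : Nontrivial A := ⟨α, 0, hα⟩
  by_contra! h
  have h1 : ∑ u, averagedRankOne U U' (U u α) β (U u α) = 0 :=
    Finset.sum_eq_zero fun u _ => by rw [h u]; rfl
  simp_rw [averagedRankOne_apply, hU.inner_map_conj] at h1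
  rw [Finset.sum_comm, Finset.sum_eq_single 0] at h1
  · simp only [hU.map_zero, hU'.map_zero, hU.multiplierCommutator_zero_right, Circle.coe_one,
      one_mul, Finset.sum_const, Finset.card_univ] at h1
    rw [← Nat.cast_smul_eq_nsmul ℂ, smul_smul, smul_eq_zero] at h1
    rcases h1 with h1 | h1
    · rcases mul_eq_zero.1 h1 with h1 | h1
      · exact Fintype.card_ne_zero (Nat.cast_eq_zero.1 h1)
      · exact hα (inner_self_eq_zero.1 h1)
    · exact hβ h1
  · intro v _ hv
    rw [← Finset.sum_smul, ← Finset.sum_mul, hU.sum_multiplierCommutator_eq_zero (hnd v hv),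
      zero_mul, zero_smul]
  · intro h0
    exact absurd (Finset.mem_univ _) h0

theorem IsMRep.finiteDimensional (hU : IsMRep m U) (hirr : IsIrreducibleFamily U) :
    FiniteDimensional ℂ A := by
  have := hirr.nontrivial
  obtain ⟨ψ, hψ⟩ := exists_ne (0 : A)
  let K : Submodule ℂ A := Submodule.span ℂ (Set.range fun v => U v ψ)
  have : FiniteDimensional ℂ K := FiniteDimensional.span_of_finite ℂ (Set.finite_range _)
  have hinv : ∀ x, ∀ φ ∈ K, U x φ ∈ K := by
    intro x φ hφ
    induction hφ using Submodule.span_induction with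
    | mem φ h =>
      obtain ⟨v, rfl⟩ := h
      simp only [hU.map_map]
      exact K.smul_mem _ (Submodule.subset_span ⟨x + v, rfl⟩)
    | zero => simp
    | add a b _ _ ha hb => rw [map_add]; exact K.add_mem ha hb
    | smul c a _ ha => rw [map_smul]; exact K.smul_mem _ ha
  rcases hirr.eq_bot_or_eq_top K K.closed_of_finiteDimensional hinv with h | h
  · refine absurd ?_ hψ
    have : ψ ∈ K := Submodule.subset_span ⟨0, hU.map_zero ψ⟩
    rwa [h, Submodule.mem_bot] at this
  · rw [h] at this
    exact Module.Finite.equiv (Submodule.topEquiv (R := ℂ) (M := A))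

end MRep

/-! ### Schur's lemma -/

section Schur

variable {V : Type*} {A : Type*} [NormedAddCommGroup A] [InnerProductSpace ℂ A]
  {B : Type*} [NormedAddCommGroup B] [InnerProductSpace ℂ B]
  {U : V → (A ≃ₗᵢ[ℂ] A)} {U' : V → (B ≃ₗᵢ[ℂ] B)}

theorem IsIrreducibleFamily.exists_eq_smul [FiniteDimensional ℂ A] (hirr : IsIrreducibleFamily U)
    (S : A →ₗ[ℂ] A) (hS : ∀ v ψ, S (U v ψ) = U v (S ψ)) : ∃ c : ℂ, ∀ ψ, S ψ = c • ψ := by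
  have := hirr.nontrivial
  obtain ⟨c, hc⟩ := Module.End.exists_eigenvalue S
  refine ⟨c, fun ψ => ?_⟩
  rcases hirr.eq_bot_or_eq_top (Module.End.eigenspace S c)
    (Submodule.closed_of_finiteDimensional _) (fun x φ hφ => by
      rw [Module.End.mem_eigenspace_iff] at hφ ⊢
      rw [hS, hφ, map_smul]) with h | h
  · exact absurd h hc
  · exact Module.End.mem_eigenspace_iff.1 (h ▸ Submodule.mem_top)

/-- By Schur `T* T` is a scalar `c > 0`, so `T / √c` is isometric; its range is invariant, hence
everything. -/
theorem IsIrreducibleFamily.exists_unitary_of_intertwiner [FiniteDimensional ℂ A] [CompleteSpace B]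
    (hU : IsIrreducibleFamily U) (hU' : IsIrreducibleFamily U') (T : A →L[ℂ] B) (hT0 : T ≠ 0)
    (hT : ∀ v ψ, T (U v ψ) = U' v (T ψ)) :
    ∃ S : A ≃ₗᵢ[ℂ] B, ∀ v ψ, S (U v ψ) = U' v (S ψ) := by
  have : CompleteSpace A := FiniteDimensional.complete ℂ A
  obtain ⟨c, hc⟩ := hU.exists_eq_smul ((T.adjoint ∘L T : A →L[ℂ] A) : A →ₗ[ℂ] A) (by
    intro v ψ
    refine ext_inner_right ℂ fun φ => ?_
    -- Testing against `U v η` lets unitarity replace an intertwining relation for the adjoint.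
    obtain ⟨η, rfl⟩ := (U v).surjective φ
    simp only [ContinuousLinearMap.coe_coe, ContinuousLinearMap.comp_apply, hT,
      ContinuousLinearMap.adjoint_inner_left, LinearIsometryEquiv.inner_map_map])
  have hnorm : ∀ ψ, ‖T ψ‖ ^ 2 = c.re * ‖ψ‖ ^ 2 := by
    intro ψ
    have h1 : ⟪ψ, (T.adjoint ∘L T) ψ⟫_ℂ = ⟪T ψ, T ψ⟫_ℂ := by
      rw [ContinuousLinearMap.comp_apply, ContinuousLinearMap.adjoint_inner_right]
    have h2 := hc ψ
    rw [ContinuousLinearMap.coe_coe] at h2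
    rw [h2, inner_smul_right, inner_self_eq_norm_sq_to_K, inner_self_eq_norm_sq_to_K] at h1
    have h3 : c * ((‖ψ‖ ^ 2 : ℝ) : ℂ) = ((‖T ψ‖ ^ 2 : ℝ) : ℂ) := by
      push_cast
      exact h1
    have h4 := congrArg Complex.re h3
    rw [Complex.re_mul_ofReal, Complex.ofReal_re] at h4
    exact h4.symm
  obtain ⟨ψ₀, hψ₀⟩ : ∃ ψ, T ψ ≠ 0 := by
    by_contra! h
    exact hT0 (ContinuousLinearMap.ext h)
  have hcpos : 0 < c.re := by
    have h1 : 0 < ‖T ψ₀‖ ^ 2 := by positivity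
    rw [hnorm] at h1
    exact pos_of_mul_pos_left h1 (by positivity)
  let r : ℝ := (Real.sqrt c.re)⁻¹
  have hr : 0 < r := inv_pos.2 (Real.sqrt_pos.2 hcpos)
  have hr0 : (r : ℂ) ≠ 0 := by exact_mod_cast hr.ne'
  let J : A →ₗᵢ[ℂ] B :=
    { toLinearMap := (r : ℂ) • (T : A →ₗ[ℂ] B)
      norm_map' := by
        intro ψ
        have h1 : ‖T ψ‖ = Real.sqrt c.re * ‖ψ‖ := by
          rw [← Real.sqrt_sq (norm_nonneg (T ψ)), hnorm, Real.sqrt_mul hcpos.le,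
            Real.sqrt_sq (norm_nonneg ψ)]
        rw [LinearMap.smul_apply, norm_smul, ContinuousLinearMap.coe_coe, h1, Complex.norm_real,
          Real.norm_of_nonneg hr.le, ← mul_assoc, inv_mul_cancel₀ (Real.sqrt_pos.2 hcpos).ne',
          one_mul] }
  have hJ : ∀ ψ, J ψ = (r : ℂ) • T ψ := fun _ => rfl
  have hJU : ∀ v ψ, J (U v ψ) = U' v (J ψ) := by
    intro v ψ
    rw [hJ, hJ, hT, map_smul]
  have hsurj : Function.Surjective J := by
    rcases hU'.eq_bot_or_eq_top (LinearMap.range J.toLinearMap)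
      (Submodule.closed_of_finiteDimensional _) (by
        rintro x _ ⟨ψ, rfl⟩
        exact ⟨U x ψ, hJU x ψ⟩) with h | h
    · exfalso
      have h1 : J ψ₀ ∈ LinearMap.range J.toLinearMap := ⟨ψ₀, rfl⟩
      rw [h, Submodule.mem_bot, hJ, smul_eq_zero] at h1
      exact h1.elim hr0 hψ₀
    · exact LinearMap.range_eq_top.1 h
  exact ⟨LinearIsometryEquiv.ofSurjective J hsurj, hJU⟩

end Schur

/-! ### Uniqueness and dimension of the irreducible representation -/

section Card

variable {V : Type*} [AddCommGroup V] [TopologicalSpace V]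
  {A : Type*} [NormedAddCommGroup A] [InnerProductSpace ℂ A]
  {B : Type*} [NormedAddCommGroup B] [InnerProductSpace ℂ B]
  {m : V → V → Circle} {U : V → (A ≃ₗᵢ[ℂ] A)} {U' : V → (B ≃ₗᵢ[ℂ] B)}

/-- The sum is the conjugate trace of `U v`, independent of the basis; rotating the basis by `U u`
multiplies it by a phase other than 1. -/
theorem IsMRep.sum_inner_eq_zero {ι : Type*} [Fintype ι] (e : OrthonormalBasis ι ℂ A)
    (hU : IsMRep m U) {v : V} (hv : ∃ u, multiplierCommutator m u v ≠ 1) :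
    ∑ i, ⟪U v (e i), e i⟫_ℂ = 0 := by
  classical
  obtain ⟨u, hu⟩ := hv
  have key : ∀ f : OrthonormalBasis ι ℂ A, ∑ i, ⟪U v (f i), f i⟫_ℂ =
      (starRingEnd ℂ) (LinearMap.trace ℂ A (U v).toLinearEquiv.toLinearMap) := by
    intro f
    rw [LinearMap.trace_eq_sum_inner _ f, map_sum]
    refine Finset.sum_congr rfl fun i _ => ?_
    rw [inner_conj_symm]; rfl
  have h := (key (e.map (U u))).trans (key e).symm
  simp only [OrthonormalBasis.map_apply, hU.inner_map_conj] at h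
  rw [← Finset.mul_sum] at h
  by_contra h0
  have := mul_right_cancel₀ h0 (h.trans (one_mul _).symm)
  exact hu (Circle.coe_injective (this.trans Circle.coe_one.symm))

variable [Fintype V]

/-- A multiplier with nondegenerate commutator on a finite group has at most one irreducible
representation up to unitary equivalence. -/
theorem IsMRep.exists_unitary_equiv [CompleteSpace B] (hU : IsMRep m U) (hU' : IsMRep m U')
    (hnd : ∀ v, v ≠ 0 → ∃ u, multiplierCommutator m u v ≠ 1)
    (hirr : IsIrreducibleFamily U) (hirr' : IsIrreducibleFamily U') :
    ∃ S : A ≃ₗᵢ[ℂ] B, ∀ v ψ, S (U v ψ) = U' v (S ψ) := by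
  have := hirr.nontrivial
  have := hirr'.nontrivial
  have := hU.finiteDimensional hirr
  obtain ⟨α, hα⟩ := exists_ne (0 : A)
  obtain ⟨β, hβ⟩ := exists_ne (0 : B)
  obtain ⟨u, hu⟩ := hU.exists_averagedRankOne_ne_zero hU' hnd hα hβ
  exact hirr.exists_unitary_of_intertwiner hirr' _ hu
    fun v ψ => hU.averagedRankOne_intertwines hU' _ ψ β v

/-- The irreducible representation of a multiplier with nondegenerate commutator has dimension
the square root of the order of the group. -/
theorem IsMRep.finrank_sq_eq_card (hU : IsMRep m U)
    (hnd : ∀ v, v ≠ 0 → ∃ u, multiplierCommutator m u v ≠ 1) (hirr : IsIrreducibleFamily U) :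
    Module.finrank ℂ A ^ 2 = Fintype.card V := by
  classical
  have := hirr.nontrivial
  have := hU.finiteDimensional hirr
  -- Let `T α β` be the averaged operator, a scalar `c α β` by Schur, with `n c = |V| ⟪α, β⟫` on
  -- taking traces. The sum of `⟪e i, T (e j) (e i) (e j)⟫` is then `|V|`; it is also `∑ᵥ |tr U v|²
  -- = n²`, as only `v = 0` contributes.
  let e := stdOrthonormalBasis ℂ A
  have hc : ∀ α β : A, ∃ c : ℂ, ∀ ξ, averagedRankOne U U α β ξ = c • ξ := fun α β =>
    hirr.exists_eq_smul (averagedRankOne U U α β : A →ₗ[ℂ] A)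
      fun v ψ => hU.averagedRankOne_intertwines hU α ψ β v
  choose c hc using hc
  have htr : ∀ α β, (Module.finrank ℂ A : ℂ) * c α β = Fintype.card V * ⟪α, β⟫_ℂ := by
    intro α β
    have h1 : ∑ i, ⟪e i, averagedRankOne U U α β (e i)⟫_ℂ = (Module.finrank ℂ A : ℂ) * c α β := by
      simp [hc]
    rw [← h1]
    simp_rw [averagedRankOne_apply, inner_sum, inner_smul_right]
    rw [Finset.sum_comm]
    simp_rw [e.sum_inner_mul_inner, LinearIsometryEquiv.inner_map_map]
    simp
  have hsum : ∑ i, ∑ j, ⟪e i, averagedRankOne U U (e j) (e i) (e j)⟫_ℂ =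
      (Module.finrank ℂ A : ℂ) ^ 2 := by
    have h1 : ∀ i j, ⟪e i, averagedRankOne U U (e j) (e i) (e j)⟫_ℂ =
        ∑ v, ⟪U v (e j), e j⟫_ℂ * ⟪e i, U v (e i)⟫_ℂ := by
      intro i j
      simp_rw [averagedRankOne_apply, inner_sum, inner_smul_right]
    have h2 : ∑ i, ∑ j, ∑ v, ⟪U v (e j), e j⟫_ℂ * ⟪e i, U v (e i)⟫_ℂ =
        ∑ v, (∑ j, ⟪U v (e j), e j⟫_ℂ) * ∑ i, ⟪e i, U v (e i)⟫_ℂ := by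
      simp_rw [Finset.sum_mul_sum]
      rw [Finset.sum_comm' (t' := Finset.univ) (s' := fun _ => Finset.univ) (by simp)]
      rw [Finset.sum_comm]
      rw [Finset.sum_comm]
      simp_rw [Finset.sum_comm (s := (Finset.univ : Finset (Fin _))) (t := (Finset.univ : Finset V))]
    simp_rw [h1]
    rw [h2, Finset.sum_eq_single 0]
    · simp [hU.map_zero, sq]
    · intro v _ hv
      rw [hU.sum_inner_eq_zero e (hnd v hv), zero_mul]
    · intro h0
      exact absurd (Finset.mem_univ _) h0
  have hn : (Module.finrank ℂ A : ℂ) ≠ 0 := by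
    exact_mod_cast (Module.finrank_pos (R := ℂ) (M := A)).ne'
  have hfin : (Module.finrank ℂ A : ℂ) * (Module.finrank ℂ A : ℂ) ^ 2 =
      (Module.finrank ℂ A : ℂ) * Fintype.card V := by
    rw [← hsum]
    simp_rw [Finset.mul_sum, hc, inner_smul_right, ← mul_assoc, htr]
    simp [OrthonormalBasis.inner_eq_ite, mul_comm]
  exact_mod_cast mul_left_cancel₀ hn hfin

end Card

/-! ### Uniqueness of Fourier coefficients -/

section Density

open MeasureTheory

/-- A bounded strongly measurable function on a compact space is almost everywhere zero if its
integrals against a point-separating, conjugation-invariant monoid of continuous functions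
vanish. -/
theorem ae_eq_zero_of_forall_integral_smul_eq_zero {X : Type*} [TopologicalSpace X] [CompactSpace X]
    [T2Space X] [MeasurableSpace X] [BorelSpace X] (μ : Measure X) [IsFiniteMeasure μ]
    [μ.WeaklyRegular] {H : Type*} [NormedAddCommGroup H] [InnerProductSpace ℂ H] [CompleteSpace H]
    {F : X → H} (hF : StronglyMeasurable F) {C : ℝ} (hC : ∀ x, ‖F x‖ ≤ C)
    (M : Submonoid C(X, ℂ)) (hstar : ∀ f ∈ M, star f ∈ M)
    (hsep : ∀ x y : X, x ≠ y → ∃ f ∈ M, f x ≠ f y)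
    (hM : ∀ f ∈ M, ∫ x, f x • F x ∂μ = 0) : F =ᵐ[μ] 0 := by
  obtain ⟨t, ht, htF⟩ : ∃ t, TopologicalSpace.IsSeparable t ∧ ∀ x, F x ∈ t :=
    ⟨Set.range F, hF.isSeparable_range, fun x => ⟨x, rfl⟩⟩
  -- Separability of the range reduces the claim to scalar functions `c ∘ F`.
  refine ae_eq_zero_of_forall_dual_of_isSeparable ℂ ht (fun c => ?_) (Filter.Eventually.of_forall htF)
  have hc : ∀ f ∈ M, ∫ x, f x * c (F x) ∂μ = 0 := by
    intro f hf
    have hfF : Integrable (fun x => f x • F x) μ := by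
      refine Integrable.of_bound
        (f.continuous.aestronglyMeasurable.smul hF.aestronglyMeasurable) (‖f‖ * C)
        (Filter.Eventually.of_forall fun x => ?_)
      rw [norm_smul]
      exact mul_le_mul (f.norm_coe_le_norm x) (hC x) (norm_nonneg _) (norm_nonneg _)
    have h := c.integral_comp_comm hfF
    rw [hM f hf, map_zero] at h
    simpa [map_smul] using h
  have hg : MemLp (fun x => (starRingEnd ℂ) (c (F x))) 2 μ := by
    refine MemLp.of_bound ?_ (‖c‖ * C) (Filter.Eventually.of_forall fun x => ?_)
    · exact (Complex.continuous_conj.comp c.continuous).comp_aestronglyMeasurable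
        hF.aestronglyMeasurable
    · rw [RCLike.norm_conj]
      exact (c.le_opNorm _).trans (mul_le_mul_of_nonneg_left (hC x) (norm_nonneg _))
  let Λ : C(X, ℂ) →L[ℂ] ℂ := innerSL ℂ (hg.toLp _) ∘L ContinuousMap.toLp 2 μ ℂ
  have hΛ : ∀ f, Λ f = ∫ x, f x * c (F x) ∂μ := by
    intro f
    change ⟪hg.toLp _, ContinuousMap.toLp 2 μ ℂ f⟫_ℂ = _
    rw [L2.inner_def]
    refine integral_congr_ae ?_
    filter_upwards [hg.coeFn_toLp, ContinuousMap.coeFn_toLp (p := 2) (𝕜 := ℂ) μ f] with x hx hx'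
    rw [hx, hx']
    simp
  -- As `M` is a monoid, this algebra is just its linear span, where `Λ` vanishes; Stone–Weierstrass
  -- makes it dense.
  let S : StarSubalgebra ℂ C(X, ℂ) :=
    { Algebra.adjoin ℂ (M : Set C(X, ℂ)) with
      star_mem' := by
        intro f hf
        change star f ∈ Algebra.adjoin ℂ (M : Set C(X, ℂ))
        induction hf using Algebra.adjoin_induction with
        | mem f hf => exact Algebra.subset_adjoin (hstar f hf)
        | algebraMap r =>
          rw [← algebraMap_star_comm]
          exact Subalgebra.algebraMap_mem _ _
        | add f g _ _ hf hg => rw [star_add]; exact add_mem hf hg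
        | mul f g _ _ hf hg => rw [star_mul]; exact mul_mem hg hf }
  have hS : S.topologicalClosure = ⊤ := by
    refine ContinuousMap.starSubalgebra_topologicalClosure_eq_top_of_separatesPoints S ?_
    intro x y hxy
    obtain ⟨f, hf, hne⟩ := hsep x y hxy
    exact ⟨f, ⟨f, Algebra.subset_adjoin hf, rfl⟩, hne⟩
  have hΛS : ∀ f ∈ S, Λ f = 0 := by
    intro f hf
    have hspan : Subalgebra.toSubmodule (Algebra.adjoin ℂ (M : Set C(X, ℂ))) =
        Submodule.span ℂ (M : Set C(X, ℂ)) := by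
      refine Algebra.adjoin_eq_span_of_subset ℂ ?_
      rw [Submonoid.closure_eq]
      exact Submodule.subset_span
    have hle : Submodule.span ℂ (M : Set C(X, ℂ)) ≤ LinearMap.ker (Λ : C(X, ℂ) →ₗ[ℂ] ℂ) :=
      Submodule.span_le.2 fun f hf => by
        change Λ f = 0
        rw [hΛ, hc f hf]
    exact hle (hspan ▸ (show f ∈ Subalgebra.toSubmodule (Algebra.adjoin ℂ (M : Set C(X, ℂ)))
      from hf))
  have hΛ0 : ∀ f, Λ f = 0 := by
    intro f
    have hf : f ∈ closure (S : Set C(X, ℂ)) := by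
      rw [← StarSubalgebra.topologicalClosure_coe, hS]
      trivial
    exact closure_minimal (t := {f | Λ f = 0}) hΛS (isClosed_eq Λ.continuous continuous_const) hf
  have hzero : hg.toLp _ = 0 := by
    have hall : ∀ φ : Lp ℂ 2 μ, ⟪hg.toLp _, φ⟫_ℂ = 0 := fun φ =>
      (ContinuousMap.toLp_denseRange ℂ μ ℂ (p := 2) (by simp)).induction_on φ
        (isClosed_eq (by fun_prop) continuous_const) hΛ0
    exact inner_self_eq_zero.1 (hall _)
  have hae := hg.coeFn_toLp
  rw [hzero] at hae
  filter_upwards [hae, Lp.coeFn_zero ℂ 2 μ] with x hx hx'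
  rw [hx', Pi.zero_apply] at hx
  exact (map_eq_zero (starRingEnd ℂ)).1 hx.symm

end Density

/-! ### Symplectic bicharacters and maximal isotropic subgroups -/

theorem le_halfSubgroup {G : Type*} [AddCommGroup G] (L : AddSubgroup G) : L ≤ halfSubgroup L :=
  fun _ hx => L.nsmul_mem hx 2

section Bicharacter

variable {G : Type*} [AddCommGroup G] [TopologicalSpace G] {m : G → G → Circle}

theorem IsBicharacter.map_zero_left (hm : IsBicharacter m) (y : G) : m 0 y = 1 := by
  have h := hm.map_add_left 0 0 y
  rw [add_zero] at h
  exact left_eq_mul.1 h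

theorem IsBicharacter.map_zero_right (hm : IsBicharacter m) (x : G) : m x 0 = 1 := by
  have h := hm.map_add_right x 0 0
  rw [add_zero] at h
  exact left_eq_mul.1 h

theorem IsBicharacter.map_neg_left (hm : IsBicharacter m) (x y : G) : m (-x) y = (m x y)⁻¹ := by
  rw [eq_inv_iff_mul_eq_one, ← hm.map_add_left, neg_add_cancel, hm.map_zero_left]

theorem IsBicharacter.map_neg_right (hm : IsBicharacter m) (x y : G) : m x (-y) = (m x y)⁻¹ := by
  rw [eq_inv_iff_mul_eq_one, ← hm.map_add_right, neg_add_cancel, hm.map_zero_right]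

theorem IsBicharacter.map_two_nsmul_left (hm : IsBicharacter m) (x y : G) :
    m (2 • x) y = m x (2 • y) := by
  rw [two_nsmul, two_nsmul, hm.map_add_left, hm.map_add_right]

theorem IsBicharacter.isIsotropic_closure (hm : IsBicharacter m) {s : Set G}
    (hs : ∀ x ∈ s, ∀ y ∈ s, m x y = 1) : IsIsotropic m (AddSubgroup.closure s) := by
  intro x hx y hy
  induction hx, hy using AddSubgroup.closure_induction₂ with
  | mem x y hx hy => exact hs x hx y hy
  | zero_left y _ => exact hm.map_zero_left y
  | zero_right x _ => exact hm.map_zero_right x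
  | add_left x y z _ _ _ h₁ h₂ => rw [hm.map_add_left, h₁, h₂, one_mul]
  | add_right x y z _ _ _ h₁ h₂ => rw [hm.map_add_right, h₁, h₂, one_mul]
  | neg_left x y _ _ h => rw [hm.map_neg_left, h, inv_one]
  | neg_right x y _ _ h => rw [hm.map_neg_right, h, inv_one]

theorem IsSymplecticBicharacter.swap (hm : IsSymplecticBicharacter m) (x y : G) :
    m y x = (m x y)⁻¹ := by
  rw [eq_inv_iff_mul_eq_one, hm.mul_swap]

theorem IsSymplecticBicharacter.multiplierCommutator_eq (hm : IsSymplecticBicharacter m)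
    (x y : G) : multiplierCommutator m x y = m (2 • x) y := by
  rw [multiplierCommutator, hm.swap x y, div_inv_eq_mul, two_nsmul, hm.map_add_left]

theorem IsSymplecticBicharacter.eq_zero_of_forall (hm : IsSymplecticBicharacter m) {y : G}
    (hy : ∀ x, m x y = 1) : y = 0 := by
  obtain ⟨e, he⟩ := hm.iso
  have h : e (Multiplicative.ofAdd y) = e 1 := by
    refine DFunLike.ext _ _ fun x => ?_
    have h1 := he x.toAdd y
    have h2 := he x.toAdd 0
    rw [hy] at h1
    rw [hm.map_zero_right] at h2
    exact h1.trans h2.symm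
  exact Multiplicative.ofAdd.injective (e.injective h)

/-- A maximal isotropic subgroup contains its annihilator. -/
theorem IsSymplecticBicharacter.mem_of_maximal (hm : IsSymplecticBicharacter m) {L : AddSubgroup G}
    (hL : Maximal (IsIsotropic m) L) {x : G} (hx : ∀ a ∈ L, m a x = 1) : x ∈ L := by
  have hiso : IsIsotropic m (AddSubgroup.closure (insert x (L : Set G))) := by
    refine hm.isIsotropic_closure ?_
    rintro y (rfl | hy) z (rfl | hz)
    · exact hm.self_eq_one _
    · rw [hm.swap z, hx z hz, inv_one]
    · exact hx y hy
    · exact hL.1 y hy z hz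
  have hle : L ≤ AddSubgroup.closure (insert x (L : Set G)) := fun a ha =>
    AddSubgroup.subset_closure (Set.mem_insert_of_mem _ ha)
  exact hL.2 hiso hle (AddSubgroup.subset_closure (Set.mem_insert _ _))

/-- Doubling maps `L/2` onto `L`, so this is self-annihilation of `L`. It yields nondegeneracy on
the quotient. -/
theorem IsSymplecticBicharacter.mem_iff_forall_halfSubgroup (hm : IsSymplecticBicharacter m)
    (h2 : Function.Surjective (fun x : G => 2 • x)) {L : AddSubgroup G}
    (hL : Maximal (IsIsotropic m) L) {x : G} :
    x ∈ L ↔ ∀ y ∈ halfSubgroup L, m (2 • y) x = 1 := by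
  constructor
  · intro hx y hy
    exact hL.1 _ hy _ hx
  · intro h
    refine hm.mem_of_maximal hL fun a ha => ?_
    obtain ⟨y, rfl⟩ := h2 a
    exact h y ha

theorem IsSymplecticBicharacter.mem_halfSubgroup_iff (hm : IsSymplecticBicharacter m)
    {L : AddSubgroup G} (hL : Maximal (IsIsotropic m) L) {x : G} :
    x ∈ halfSubgroup L ↔ ∀ a ∈ L, m (2 • a) x = 1 := by
  constructor
  · intro hx a ha
    rw [hm.map_two_nsmul_left]
    exact hL.1 _ ha _ hx
  · intro h
    refine hm.mem_of_maximal hL fun a ha => ?_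
    change m a (2 • x) = 1
    rw [← hm.map_two_nsmul_left]
    exact h a ha

end Bicharacter

/-! ### Compactness of `L/2` and openness of `L` in it -/

section Topology

variable {G : Type*} [AddCommGroup G] [TopologicalSpace G] [IsTopologicalAddGroup G]

/-- Translates of a compact neighbourhood by a countable dense set cover `G`. This enables the open
mapping theorem, making doubling a homeomorphism. -/
theorem sigmaCompactSpace_of_separableSpace [LocallyCompactSpace G]
    [TopologicalSpace.SeparableSpace G] : SigmaCompactSpace G := by
  obtain ⟨D, hDc, hD⟩ := TopologicalSpace.exists_countable_dense G
  obtain ⟨K, hK, hK0⟩ := exists_compact_mem_nhds (0 : G)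
  have hcover : ⋃₀ ((fun d => (fun k => d + k) '' K) '' D) = Set.univ := by
    refine Set.eq_univ_of_forall fun x => ?_
    have hx : (fun d => x - d) ⁻¹' K ∈ nhds x := by
      have hc : ContinuousAt (fun d => x - d) x := by fun_prop
      exact hc (by simpa using hK0)
    obtain ⟨d, hd, hdD⟩ := mem_closure_iff_nhds.1 (hD x) _ hx
    exact ⟨_, ⟨d, hdD, rfl⟩, x - d, hd, add_sub_cancel d x⟩
  refine SigmaCompactSpace.of_countable _ (hDc.image _) ?_ hcover
  rintro _ ⟨d, _, rfl⟩
  exact hK.image (by fun_prop)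

theorem isCompact_halfSubgroup [T2Space G] [LocallyCompactSpace G]
    [TopologicalSpace.SeparableSpace G] (h2 : Function.Bijective (fun x : G => 2 • x))
    {L : AddSubgroup G} (hL : IsCompact (L : Set G)) : IsCompact (halfSubgroup L : Set G) := by
  have := sigmaCompactSpace_of_separableSpace (G := G)
  have hc : Continuous (nsmulAddMonoidHom 2 : G →+ G) := by
    change Continuous (fun x : G => 2 • x)
    fun_prop
  have ho : IsOpenMap (nsmulAddMonoidHom 2 : G →+ G) :=
    AddMonoidHom.isOpenMap_of_sigmaCompact _ h2.surjective hc
  have hh : IsHomeomorph (nsmulAddMonoidHom 2 : G →+ G) := ⟨hc, ho, h2⟩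
  exact hh.isClosedEmbedding.isCompact_preimage hL

/-- On `L/2` the pairing `m (2y) x` squares to `m (2y) (2x) = 1`, so it is `±1`. The complement of
`L` is the projection, along a compact factor, of the closed set where it is `-1`. -/
theorem IsSymplecticBicharacter.isOpen_addSubgroupOf_halfSubgroup {m : G → G → Circle}
    (hm : IsSymplecticBicharacter m)
    (h2 : Function.Surjective (fun x : G => 2 • x)) {L : AddSubgroup G}
    (hL : Maximal (IsIsotropic m) L) (hc : IsCompact (halfSubgroup L : Set G)) :
    IsOpen (L.addSubgroupOf (halfSubgroup L) : Set (halfSubgroup L)) := by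
  have : CompactSpace (halfSubgroup L) := isCompact_iff_compactSpace.1 hc
  let f : halfSubgroup L × halfSubgroup L → ℂ := fun p => (m (2 • (p.2 : G)) p.1 : Circle)
  have hf : Continuous f := by
    have h1 : Continuous fun p : halfSubgroup L × halfSubgroup L =>
        ((2 • (p.2 : G), (p.1 : G)) : G × G) := by fun_prop
    exact continuous_subtype_val.comp (hm.continuous.comp h1)
  have hval : ∀ p, f p = 1 ∨ f p = -1 := by
    intro p
    have h1 : m (2 • (p.2 : G)) p.1 * m (2 • (p.2 : G)) p.1 = 1 := by
      rw [← hm.map_add_right, ← two_nsmul]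
      exact hL.1 _ p.2.2 _ p.1.2
    have h2 : f p * f p = 1 := by
      rw [← Circle.coe_mul, h1, Circle.coe_one]
    exact mul_self_eq_one_iff.1 h2
  have hclosed : IsClosed (Prod.fst '' (f ⁻¹' {-1})) :=
    isClosedMap_fst_of_compactSpace _ (isClosed_singleton.preimage hf)
  have heq : (L.addSubgroupOf (halfSubgroup L) : Set (halfSubgroup L)) =
      (Prod.fst '' (f ⁻¹' {-1}))ᶜ := by
    ext x
    rw [SetLike.mem_coe, AddSubgroup.mem_addSubgroupOf, hm.mem_iff_forall_halfSubgroup h2 hL,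
      Set.mem_compl_iff]
    constructor
    · rintro h ⟨p, hp, rfl⟩
      have h1 : f p = 1 := by
        change ((m (2 • (p.2 : G)) p.1 : Circle) : ℂ) = 1
        rw [h _ p.2.2, Circle.coe_one]
      rw [Set.mem_preimage, h1, Set.mem_singleton_iff] at hp
      norm_num at hp
    · intro h y hy
      rcases hval (x, ⟨y, hy⟩) with h1 | h1
      · exact Circle.coe_injective (h1.trans Circle.coe_one.symm)
      · exact absurd ⟨(x, ⟨y, hy⟩), h1, rfl⟩ h
  rw [heq]
  exact hclosed.isOpen_compl

end Topology

/-! ### The vacuum space and the descended representation -/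

theorem isClosed_vacuumSpace {G : Type*} [AddCommGroup G] {H : Type*} [NormedAddCommGroup H]
    [InnerProductSpace ℂ H] (W : G → (H ≃ₗᵢ[ℂ] H)) (L : AddSubgroup G) :
    IsClosed (vacuumSpace W L : Set H) := by
  have h : (vacuumSpace W L : Set H) = ⋂ a ∈ L, {ψ | W a ψ = ψ} := by
    ext ψ
    simp only [Set.mem_iInter]
    rfl
  rw [h]
  exact isClosed_biInter fun a _ => isClosed_eq (W a).continuous continuous_id

section Vacuum

variable {G : Type*} [AddCommGroup G] [TopologicalSpace G] {m : G → G → Circle}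
  {H : Type*} [NormedAddCommGroup H] [InnerProductSpace ℂ H]
  {W : G → (H ≃ₗᵢ[ℂ] H)} {L : AddSubgroup G}

theorem IsMRep.map_comm_of_isSymplecticBicharacter (hm : IsSymplecticBicharacter m)
    (hW : IsMRep m W) (x y : G) (ψ : H) :
    W x (W y ψ) = (m (2 • x) y : ℂ) • W y (W x ψ) := by
  rw [hW.map_map_comm, hm.multiplierCommutator_eq]

theorem IsMRep.map_neg_map (hm : IsSymplecticBicharacter m) (hW : IsMRep m W) (x : G) (ψ : H) :
    W (-x) (W x ψ) = ψ := by
  rw [hW.map_map, hm.map_neg_left, hm.self_eq_one, inv_one, Circle.coe_one, one_smul,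
    neg_add_cancel, hW.map_zero]

theorem IsMRep.inner_map_right (hm : IsSymplecticBicharacter m) (hW : IsMRep m W) (x : G)
    (φ ψ : H) : ⟪φ, W x ψ⟫_ℂ = ⟪W (-x) φ, ψ⟫_ℂ := by
  rw [← (W (-x)).inner_map_map, hW.map_neg_map hm]

theorem IsMRep.map_add_vacuum (hW : IsMRep m W) (x : G) {a : G} (ha : a ∈ L) {ψ : H}
    (hψ : ψ ∈ vacuumSpace W L) : W (x + a) ψ = ((m x a)⁻¹ : Circle) • W x ψ := by
  have h : W x (W a ψ) = m x a • W (x + a) ψ := hW.map_map x a ψ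
  rw [hψ a ha] at h
  rw [h, inv_smul_smul]

theorem IsMRep.map_mem_vacuumSpace (hm : IsSymplecticBicharacter m)
    (hL : Maximal (IsIsotropic m) L) (hW : IsMRep m W) {x : G} (hx : x ∈ halfSubgroup L) {ψ : H}
    (hψ : ψ ∈ vacuumSpace W L) : W x ψ ∈ vacuumSpace W L := by
  intro a ha
  rw [hW.map_comm_of_isSymplecticBicharacter hm, hψ a ha, (hm.mem_halfSubgroup_iff hL).1 hx a ha,
    Circle.coe_one, one_smul]

/-- Some `W a` with `a ∈ L` fixes `ψ` but multiplies `W x φ` by a phase other than 1; eigenvectors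
of a unitary for distinct eigenvalues are orthogonal. -/
theorem IsMRep.inner_map_eq_zero (hm : IsSymplecticBicharacter m)
    (hL : Maximal (IsIsotropic m) L) (hW : IsMRep m W) {x : G} (hx : x ∉ halfSubgroup L) {φ ψ : H}
    (hφ : φ ∈ vacuumSpace W L) (hψ : ψ ∈ vacuumSpace W L) : ⟪W x φ, ψ⟫_ℂ = 0 := by
  rw [hm.mem_halfSubgroup_iff hL] at hx
  push Not at hx
  obtain ⟨a, ha, hne⟩ := hx
  have h : ⟪W a (W x φ), W a ψ⟫_ℂ = ⟪W x φ, ψ⟫_ℂ := (W a).inner_map_map _ _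
  rw [hW.map_comm_of_isSymplecticBicharacter hm, hφ a ha, hψ a ha, inner_smul_left] at h
  by_contra h0
  have h1 := mul_right_cancel₀ h0 (h.trans (one_mul _).symm)
  have h2 := Circle.conj_coe_mul_coe (m (2 • a) x)
  rw [h1, one_mul] at h2
  exact hne (Circle.coe_injective (h2.trans Circle.coe_one.symm))

open MeasureTheory in
/-- An `m`-representation on a nonzero space has a nonzero vector fixed by a given compact
isotropic subgroup. -/
theorem IsMRep.nontrivial_vacuumSpace [IsTopologicalAddGroup G] [T2Space G] [CompleteSpace H]
    [Nontrivial H] (hm : IsSymplecticBicharacter m) (hW : IsMRep m W)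
    (h2 : Function.Surjective (fun x : G => 2 • x)) (hL : IsIsotropic m L)
    (hLc : IsCompact (L : Set G)) : Nontrivial (vacuumSpace W L) := by
  have : CompactSpace L := isCompact_iff_compactSpace.1 hLc
  let : MeasurableSpace L := _root_.borel L
  have : BorelSpace L := ⟨rfl⟩
  let μ : Measure L := Measure.addHaar
  obtain ⟨ψ, hψ⟩ := exists_ne (0 : H)
  have hF : StronglyMeasurable fun a : L => W a ψ := by
    let : MeasurableSpace G := _root_.borel G
    have : BorelSpace G := ⟨rfl⟩
    exact (hW.borel ψ).comp_measurable (g := ((↑) : L → G)) continuous_subtype_val.measurable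
  let χ : G → C(L, ℂ) := fun y =>
    ⟨fun a => (m a y : Circle), by
      have h1 : Continuous fun a : L => (((a : G), y) : G × G) := by fun_prop
      exact continuous_subtype_val.comp (hm.continuous.comp h1)⟩
  have hχ : ∀ y (a : L), χ y a = (m a y : Circle) := fun _ _ => rfl
  let M : Submonoid C(L, ℂ) :=
    { carrier := Set.range χ
      one_mem' := ⟨0, ContinuousMap.ext fun a => by
        rw [hχ, hm.map_zero_right, Circle.coe_one, ContinuousMap.one_apply]⟩
      mul_mem' := by
        rintro _ _ ⟨y, rfl⟩ ⟨z, rfl⟩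
        exact ⟨y + z, ContinuousMap.ext fun a => by
          rw [ContinuousMap.mul_apply, hχ, hχ, hχ, hm.map_add_right, Circle.coe_mul]⟩ }
  have hstar : ∀ f ∈ M, star f ∈ M := by
    rintro _ ⟨y, rfl⟩
    exact ⟨-y, ContinuousMap.ext fun a => by
      rw [ContinuousMap.star_apply, hχ, hχ, hm.map_neg_right, Circle.coe_inv_eq_conj]
      rfl⟩
  have hsep : ∀ a b : L, a ≠ b → ∃ f ∈ M, f a ≠ f b := by
    intro a b hab
    by_contra! h
    refine hab (Subtype.ext (sub_eq_zero.1 (hm.eq_zero_of_forall fun x => ?_)))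
    have h1 : m a x = m b x := Circle.coe_injective (h _ ⟨x, rfl⟩)
    rw [hm.swap ((a : G) - b) x, sub_eq_add_neg, hm.map_add_left, hm.map_neg_left, h1,
      mul_inv_cancel, inv_one]
  -- If every Fourier coefficient vanished, `W a ψ` would be zero almost everywhere, though it has
  -- norm `‖ψ‖`.
  obtain ⟨y, hy⟩ : ∃ y, ∫ a, χ y a • W (a : G) ψ ∂μ ≠ 0 := by
    by_contra! h
    have hae := ae_eq_zero_of_forall_integral_smul_eq_zero μ hF (C := ‖ψ‖)
      (fun a => ((W a).norm_map ψ).le) M hstar hsep (by rintro _ ⟨y, rfl⟩; exact h y)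
    obtain ⟨a, ha⟩ := hae.exists
    exact hψ ((W (a : G)).map_eq_zero_iff.1 ha)
  -- `L` acts on the coefficient by the inverse of `m · y`. Halving `y` gives the `x` for which `W
  -- x` shifts that character to the trivial one.
  obtain ⟨x, rfl⟩ := h2 y
  set v : H := ∫ a, χ (2 • x) a • W (a : G) ψ ∂μ with hv
  have hWv : ∀ b ∈ L, W b v = ((m b (2 • x))⁻¹ : Circle) • v := by
    intro b hb
    have h1 : W b v = ∫ a, W b (χ (2 • x) a • W (a : G) ψ) ∂μ :=
      ((W b).toContinuousLinearEquiv.integral_comp_comm _).symm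
    rw [h1, hv, ← integral_add_left_eq_self (μ := μ) (fun a => χ (2 • x) a • W (a : G) ψ) ⟨b, hb⟩,
      Circle.smul_def, ← integral_smul]
    refine integral_congr_ae (Filter.Eventually.of_forall fun a => ?_)
    simp only [map_smul, hW.map_map, hχ, AddSubgroup.coe_add, hL b hb a a.2, Circle.coe_one,
      one_smul, hm.map_add_left, Circle.coe_mul, smul_smul, ← mul_assoc]
    rw [← Circle.coe_mul, inv_mul_cancel, Circle.coe_one, one_mul]
  refine ⟨⟨⟨W x v, fun b hb => ?_⟩, 0, fun h => ?_⟩⟩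
  · rw [hW.map_comm_of_isSymplecticBicharacter hm, hWv b hb, Circle.smul_def, map_smul, smul_smul,
      hm.map_two_nsmul_left, ← Circle.coe_mul, mul_inv_cancel, Circle.coe_one, one_smul]
  · exact hy ((W x).map_eq_zero_iff.1 (congrArg Subtype.val h))

/-- The action of `W x`, `x ∈ L/2`, on the vacuum space. -/
noncomputable def IsMRep.vacuumAction (hm : IsSymplecticBicharacter m)
    (hL : Maximal (IsIsotropic m) L) (hW : IsMRep m W) (x : halfSubgroup L) :
    vacuumSpace W L ≃ₗᵢ[ℂ] vacuumSpace W L where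
  toFun ψ := ⟨W x ψ, hW.map_mem_vacuumSpace hm hL x.2 ψ.2⟩
  invFun ψ := ⟨W (-x) ψ, hW.map_mem_vacuumSpace hm hL (neg_mem x.2) ψ.2⟩
  map_add' φ ψ := Subtype.ext (map_add (W x) _ _)
  map_smul' c ψ := Subtype.ext (map_smul (W x) _ _)
  left_inv ψ := Subtype.ext (hW.map_neg_map hm _ _)
  right_inv ψ := Subtype.ext (by simpa using hW.map_neg_map hm (-(x : G)) ψ)
  norm_map' ψ := (W x).norm_map ψ

theorem IsMRep.coe_vacuumAction (hm : IsSymplecticBicharacter m)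
    (hL : Maximal (IsIsotropic m) L) (hW : IsMRep m W) (x : halfSubgroup L)
    (ψ : vacuumSpace W L) : (hW.vacuumAction hm hL x ψ : H) = W x ψ := rfl

theorem IsMRep.exists_isVacuumDescent (hm : IsSymplecticBicharacter m)
    (hL : Maximal (IsIsotropic m) L) (hW : IsMRep m W) [DiscreteTopology (HalfQuotient L)]
    [Finite (HalfQuotient L)] : ∃ m₀ W₀, IsVacuumDescent W L m₀ W₀ := by
  let s : HalfQuotient L → halfSubgroup L := Quotient.out
  have hs : ∀ v, QuotientAddGroup.mk (s v) = v := Quotient.out_eq'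
  have hsub : ∀ x y : halfSubgroup L,
      (QuotientAddGroup.mk x : HalfQuotient L) = QuotientAddGroup.mk y → (-(x : G) + y) ∈ L := by
    intro x y h
    have h' := QuotientAddGroup.eq.1 h
    exact h'
  have hW₀ : ∀ (x y : halfSubgroup L) (ψ : vacuumSpace W L),
      (QuotientAddGroup.mk x : HalfQuotient L) = QuotientAddGroup.mk y →
      W y ψ = ((m x (-x + y))⁻¹ : Circle) • W x (ψ : H) := by
    intro x y ψ h
    rw [← hW.map_add_vacuum x (hsub x y h) ψ.2, add_neg_cancel_left]
  -- The second factor is the phase between `W` at `s v + s w` and at the chosen representative `s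
  -- (v + w)`.
  refine ⟨fun v w => m (s v) (s w) * (m (s (v + w)) (-s (v + w) + (s v + s w)))⁻¹,
    fun v => hW.vacuumAction hm hL (s v), ⟨?_, ?_, ?_⟩, ?_⟩
  · intro ψ
    refine Subtype.ext ?_
    rw [hW.coe_vacuumAction]
    -- The representative `s 0` need not be `0`, but it lies in `L` and so fixes the vacuum.
    refine ψ.2 _ ?_
    have h := hsub 0 (s 0) (hs 0).symm
    simpa using h
  · intro v w ψ
    refine Subtype.ext ?_
    have h := hW₀ (s (v + w)) (s v + s w) ψ (by rw [hs, QuotientAddGroup.mk_add, hs, hs])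
    rw [AddSubgroup.coe_add] at h
    rw [hW.coe_vacuumAction, hW.coe_vacuumAction, hW.map_map, h, Submodule.coe_smul,
      hW.coe_vacuumAction, Circle.smul_def, smul_smul, ← Circle.coe_mul]
  · intro ψ
    let : MeasurableSpace (HalfQuotient L) := _root_.borel (HalfQuotient L)
    have : BorelSpace (HalfQuotient L) := ⟨rfl⟩
    exact MeasureTheory.StronglyMeasurable.of_discrete
  · exact ⟨fun x => (m x (-x + s (QuotientAddGroup.mk x)))⁻¹, fun x ψ =>
      hW₀ x (s (QuotientAddGroup.mk x)) ψ (hs _).symm⟩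

/-- The vectors orthogonal to `W(G) Kᗮ` form a closed `W`-invariant subspace `N` containing `K`: for
`x` in `L/2` by invariance of `K`, otherwise by `IsMRep.inner_map_eq_zero`. If `N = 0` then `K = 0`;
if `N` is everything then `Kᗮ = 0`. -/
theorem IsVacuumDescent.isIrreducibleFamily [CompleteSpace H] (hm : IsSymplecticBicharacter m)
    (hL : Maximal (IsIsotropic m) L) (hW : IsMRep m W) (hirr : IsIrreducibleFamily W)
    [Nontrivial (vacuumSpace W L)] {m₀ : HalfQuotient L → HalfQuotient L → Circle}
    {W₀ : HalfQuotient L → (vacuumSpace W L ≃ₗᵢ[ℂ] vacuumSpace W L)}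
    (hd : IsVacuumDescent W L m₀ W₀) : IsIrreducibleFamily W₀ := by
  refine ⟨inferInstance, fun K hK hinv => ?_⟩
  obtain ⟨c, hc⟩ := hd.lift
  have : CompleteSpace (vacuumSpace W L) := (isClosed_vacuumSpace W L).completeSpace_coe
  have : CompleteSpace K := hK.completeSpace_coe
  have hKinv : ∀ (x : halfSubgroup L), ∀ k ∈ K, ∃ k' ∈ K, (k' : H) = W x k := by
    intro x k hk
    refine ⟨((c x)⁻¹ : Circle) • W₀ (QuotientAddGroup.mk x) k, K.smul_mem _ (hinv _ k hk), ?_⟩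
    rw [Circle.smul_def, Submodule.coe_smul, hc, smul_smul, ← Circle.coe_mul, inv_mul_cancel,
      Circle.coe_one, one_smul]
  let N : Submodule ℂ H :=
    { carrier := {φ | ∀ ψ ∈ Kᗮ, ∀ x, ⟪W x (ψ : H), φ⟫_ℂ = 0}
      add_mem' := by
        intro a b ha hb ψ hψ x
        rw [inner_add_right, ha ψ hψ x, hb ψ hψ x, add_zero]
      zero_mem' := fun _ _ _ => inner_zero_right _
      smul_mem' := by
        intro z a ha ψ hψ x
        rw [inner_smul_right, ha ψ hψ x, mul_zero] }
  have hNclosed : IsClosed (N : Set H) := by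
    have h : (N : Set H) = ⋂ ψ ∈ Kᗮ, ⋂ x, {φ | ⟪W x (ψ : H), φ⟫_ℂ = 0} := by
      ext φ
      simp only [Set.mem_iInter]
      rfl
    rw [h]
    exact isClosed_biInter fun ψ _ => isClosed_iInter fun x =>
      isClosed_eq (by fun_prop) continuous_const
  have hNinv : ∀ x, ∀ φ ∈ N, W x φ ∈ N := by
    intro y φ hφ ψ hψ x
    rw [hW.inner_map_right hm, hW.map_map, inner_smul_left, hφ ψ hψ, mul_zero]
  have hKN : ∀ k ∈ K, (k : H) ∈ N := by
    intro k hk ψ hψ x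
    by_cases hx : x ∈ halfSubgroup L
    · obtain ⟨k', hk', hkk'⟩ := hKinv ⟨-x, neg_mem hx⟩ k hk
      have h := hW.inner_map_right hm (-x) (ψ : H) (k : H)
      rw [neg_neg] at h
      rw [← h]
      change ⟪(ψ : H), W ((⟨-x, neg_mem hx⟩ : halfSubgroup L) : G) k⟫_ℂ = 0
      rw [← hkk']
      exact (Submodule.mem_orthogonal' K ψ).1 hψ k' hk'
    · exact hW.inner_map_eq_zero hm hL hx ψ.2 k.2
  rcases hirr.eq_bot_or_eq_top N hNclosed hNinv with h | h
  · left
    refine (Submodule.eq_bot_iff K).2 fun k hk => Subtype.ext ?_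
    have := hKN k hk
    rwa [h, Submodule.mem_bot] at this
  · right
    rw [← Submodule.orthogonal_eq_bot_iff, Submodule.eq_bot_iff]
    intro ψ hψ
    have h1 : (ψ : H) ∈ N := h ▸ Submodule.mem_top
    have h3 := h1 ψ hψ 0
    rw [hW.map_zero, inner_self_eq_zero] at h3
    exact Subtype.ext h3

/-- The phases of the lift cancel in commutators, so every descent has the commutator `m (2y) x`. -/
theorem IsVacuumDescent.exists_multiplierCommutator_ne_one (hm : IsSymplecticBicharacter m)
    (h2 : Function.Surjective (fun x : G => 2 • x))
    (hL : Maximal (IsIsotropic m) L) (hW : IsMRep m W)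
    [Nontrivial (vacuumSpace W L)] {m₀ : HalfQuotient L → HalfQuotient L → Circle}
    {W₀ : HalfQuotient L → (vacuumSpace W L ≃ₗᵢ[ℂ] vacuumSpace W L)}
    (hd : IsVacuumDescent W L m₀ W₀) (v : HalfQuotient L) (hv : v ≠ 0) :
    ∃ u, multiplierCommutator m₀ u v ≠ 1 := by
  obtain ⟨c, hc⟩ := hd.lift
  obtain ⟨x, rfl⟩ := QuotientAddGroup.mk_surjective v
  have hx : (x : G) ∉ L := fun h => hv ((QuotientAddGroup.eq_zero_iff x).2 h)
  rw [hm.mem_iff_forall_halfSubgroup h2 hL] at hx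
  push Not at hx
  obtain ⟨y, hy, hne⟩ := hx
  refine ⟨QuotientAddGroup.mk ⟨y, hy⟩, fun h => hne ?_⟩
  obtain ⟨ψ, hψ⟩ := exists_ne (0 : vacuumSpace W L)
  have h1 := congrArg Subtype.val
    (hd.isMRep.map_map_comm (QuotientAddGroup.mk ⟨y, hy⟩) (QuotientAddGroup.mk x) ψ)
  rw [h, Circle.coe_one, one_smul] at h1
  simp only [hc, map_smul] at h1
  rw [hW.map_comm_of_isSymplecticBicharacter hm, smul_comm (c x : ℂ)] at h1
  set φ : H := (c ⟨y, hy⟩ : ℂ) • (c x : ℂ) • W x (W y ψ) with hφ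
  have hφ0 : φ ≠ 0 := by
    rw [hφ]
    simpa using hψ
  have h3 : (m (2 • y) x : ℂ) • φ = ((1 : Circle) : ℂ) • φ := by
    rw [Circle.coe_one, one_smul, hφ, smul_comm (m (2 • y) x : ℂ), h1, smul_comm (c x : ℂ)]
  exact Circle.coe_injective (smul_left_injective ℂ hφ0 h3)

end Vacuum

/-! ### Order of the quotient and the final count -/

theorem card_halfQuotient_eq_two_pow {G : Type*} [AddCommGroup G] (L : AddSubgroup G)
    [Finite (HalfQuotient L)] : ∃ k, Nat.card (HalfQuotient L) = 2 ^ k := by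
  have : Fact (Nat.Prime 2) := ⟨Nat.prime_two⟩
  have := Fintype.ofFinite (HalfQuotient L)
  let : Module (ZMod 2) (HalfQuotient L) := AddCommGroup.zmodModule (n := 2) (by
    intro v
    obtain ⟨x, rfl⟩ := QuotientAddGroup.mk_surjective v
    exact (QuotientAddGroup.eq_zero_iff (2 • x)).2 x.2)
  refine ⟨Module.finrank (ZMod 2) (HalfQuotient L), ?_⟩
  rw [Nat.card_eq_fintype_card, Module.card_eq_pow_finrank (K := ZMod 2), ZMod.card]

theorem card_halfQuotient_ne_one {G : Type*} [AddCommGroup G]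
    (h2 : Function.Surjective (fun x : G => 2 • x)) {L : AddSubgroup G}
    (hL2 : L ≠ doubleSubgroup L) : Nat.card (HalfQuotient L) ≠ 1 := by
  intro h
  have := (Nat.card_eq_one_iff_unique.1 h).1
  have hle : halfSubgroup L ≤ L := fun x hx => by
    have hmem : (⟨x, hx⟩ : halfSubgroup L) ∈ L.addSubgroupOf (halfSubgroup L) :=
      (QuotientAddGroup.eq_zero_iff _).1 (Subsingleton.elim _ _)
    exact hmem
  refine hL2 (le_antisymm (fun a ha => ?_) ?_)
  · obtain ⟨y, rfl⟩ := h2 a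
    exact ⟨y, hle ha, rfl⟩
  · rintro _ ⟨y, hy, rfl⟩
    exact le_halfSubgroup L hy

theorem theorem4p8 {G : Type*} [AddCommGroup G] [TopologicalSpace G] [IsTopologicalAddGroup G]
    [T2Space G] [LocallyCompactSpace G] [TopologicalSpace.SeparableSpace G]
    (h2reg : Function.Bijective (fun x : G => 2 • x))
    (m : G → G → Circle) (hm : IsSymplecticBicharacter m)
    (L : AddSubgroup G) (hL : Maximal (IsIsotropic m) L) (hLc : IsCompact (L : Set G))
    (hL2 : L ≠ doubleSubgroup L)
    {H : Type*} [NormedAddCommGroup H] [InnerProductSpace ℂ H] [CompleteSpace H]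
    (W : G → (H ≃ₗᵢ[ℂ] H)) (hW : IsMRep m W) (hWirr : IsIrreducibleFamily W) :
    (∃ m₀ W₀, IsVacuumDescent W L m₀ W₀) ∧
    (∀ m₀ W₀, IsVacuumDescent W L m₀ W₀ →
      IsIrreducibleFamily W₀ ∧
      ∀ (K : Type*) [NormedAddCommGroup K] [InnerProductSpace ℂ K] [CompleteSpace K]
        (W' : HalfQuotient L → (K ≃ₗᵢ[ℂ] K)),
        IsMRep m₀ W' → IsIrreducibleFamily W' →
        ∃ T : vacuumSpace W L ≃ₗᵢ[ℂ] K, ∀ v ψ, T (W₀ v ψ) = W' v (T ψ)) ∧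
    ∃ d : ℕ, 0 < d ∧ Module.finrank ℂ (vacuumSpace W L) = 2 ^ d ∧
      Nat.card (HalfQuotient L) = 2 ^ (2 * d) := by
  have hhalf := isCompact_halfSubgroup h2reg hLc
  have : CompactSpace (halfSubgroup L) := isCompact_iff_compactSpace.1 hhalf
  have : DiscreteTopology (HalfQuotient L) :=
    QuotientAddGroup.discreteTopology
      (hm.isOpen_addSubgroupOf_halfSubgroup h2reg.surjective hL hhalf)
  have : Finite (HalfQuotient L) := finite_of_compact_of_discrete
  have := Fintype.ofFinite (HalfQuotient L)
  have := hWirr.nontrivial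
  have := hW.nontrivial_vacuumSpace hm h2reg.surjective hL.1 hLc
  have hex := hW.exists_isVacuumDescent hm hL
  refine ⟨hex, fun m₀ W₀ hd => ?_, ?_⟩
  · have hirr := hd.isIrreducibleFamily hm hL hW hWirr
    exact ⟨hirr, fun K _ _ _ W' hW' hirr' => hd.isMRep.exists_unitary_equiv hW'
      (hd.exists_multiplierCommutator_ne_one hm h2reg.surjective hL hW) hirr hirr'⟩
  · obtain ⟨m₀, W₀, hd⟩ := hex
    have hsq := hd.isMRep.finrank_sq_eq_card
      (hd.exists_multiplierCommutator_ne_one hm h2reg.surjective hL hW)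
      (hd.isIrreducibleFamily hm hL hW hWirr)
    rw [← Nat.card_eq_fintype_card] at hsq
    obtain ⟨k, hk⟩ := card_halfQuotient_eq_two_pow L
    -- The dimension divides its square `2 ^ k`, hence is itself a power of 2; this forces `k = 2d`.
    obtain ⟨d, -, hdim⟩ := (Nat.dvd_prime_pow Nat.prime_two).1
      (hk ▸ hsq ▸ Dvd.intro_left _ (pow_succ _ 1).symm :
        Module.finrank ℂ (vacuumSpace W L) ∣ 2 ^ k)
    have hcard : Nat.card (HalfQuotient L) = 2 ^ (2 * d) := by
      rw [← hsq, hdim, ← pow_mul, mul_comm]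
    refine ⟨d, Nat.pos_of_ne_zero ?_, hdim, hcard⟩
    rintro rfl
    exact card_halfQuotient_ne_one h2reg.surjective hL2 hcard
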